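/- Let $X$ be a Hausdorff, locally paracompact space (every point has a closed paracompact neighborhood), let $\Bbbk\in\{\mathbb R,\mathbb C\}$, and let $\pi:\mathcal E\to X$ be a continuous Banach bundle over $\Bbbk$: $\pi$ is a continuous open surjection, the fibers $\mathcal E_x=\pi^{-1}(x)$ are Banach spaces whose norms $\|\cdot\|_x$ glue to a continuous function on $\mathcal E$, fiberwise addition and scalar multiplication are continuous, and a net $p_\lambda$ in $\mathcal E$ converges to $0_x$ if and only if $\|p_\lambda\|\to 0$ and $\pi(p_\lambda)\to x$. Assume that $\mathcal E$ is subhomogeneous, i.e. $\sup_{x}\dim\mathcal E_x<\infty$. Let $\Gamma_b(\mathcal E)$ be the space of bounded continuous sections with the supremum norm, and let $\mathcal S(\Gamma_b(\mathcal E))$ be the set of continuous seminorms on it, with the topology of pointwise convergence. A norm $q$ on $\mathcal E_x$ is regarded as the seminorm $s\mapsto q(s(x))$ on $\Gamma_b(\mathcal E)$. Then there is a map $x\mapsto\mathcal K_x$ assigning to every $x\in X$ a set $\mathcal K_x$ of Hilbert norms on $\mathcal E_x$ (norms induced by inner products) such that: 1. (equivalence) there is a constant $C>0$ with $q(v)\le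 C\|v\|_x$ and $\|v\|_x\le C\,q(v)$ for all $x\in X$, $q\in\mathcal K_x$, $v\in\mathcal E_x$; and $$\sup_{x\in X}\ \sup_{q\in\mathcal K_x} d_{BM}\big((\mathcal E_x,\|\cdot\|_x),(\mathcal E_x,q)\big)<\infty,$$ where $d_{BM}(E,F)=\inf\{\|T\|\cdot\|T^{-1}\| : T:E\to F \text{ a linear isomorphism}\}$ is the Banach--Mazur distance; 2. (lower semicontinuity) as a map from $X$ to subsets of $\mathcal S(\Gamma_b(\mathcal E))$, $\mathcal K$ is lower semicontinuous: if $x\in X$ and $V\subseteq\mathcal S(\Gamma_b(\mathcal E))$ is open with $\mathcal K_x\cap V\neq\emptyset$, then $\mathcal K_{x'}\cap V\ne\emptyset$ for all $x'$ in some neighborhood of $x$; 3. every $\mathcal K_x$ is non-empty, is closed in $\mathcal S(\Gamma_b(\mathcal E))$, and is $\ell^2$-convex: for $p,q\in\mathcal K_x$ and $t\in[0,1]$, the norm $(t\,p^2+(1-t)\,q^2)^{1/2}$ belongs to $\mathcal K_x$. -/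

import Mathlib

open Filter Topology
open scoped ENNReal NNReal

/-- The total space of a family `E` of fibers over `X`. It carries no default topology. -/
structure BundleTotal {X : Type*} (E : X → Type*) where
  /-- the base point, i.e. the bundle projection -/
  base : X
  /-- the vector in the fiber over the base point -/
  vec : E base

/-- Pairs of vectors lying in a common fiber, i.e. the fiber product of the total space with
itself over the base. -/
structure FiberSquare {X : Type*} (E : X → Type*) where
  base : X
  fst : E base
  snd : E base

namespace FiberSquare

variable {X : Type*} {E : X → Type*}

/-- The inclusion of the fiber product into the square of the total space. -/
def toProd (p : FiberSquare E) : BundleTotal E × BundleTotal E :=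
  (⟨p.base, p.fst⟩, ⟨p.base, p.snd⟩)

instance [TopologicalSpace (BundleTotal E)] : TopologicalSpace (FiberSquare E) :=
  TopologicalSpace.induced toProd inferInstance

end FiberSquare

/-- Continuous Banach bundles: the projection is a continuous open surjection (surjectivity being
automatic, as fibers contain `0`), the fibers are Banach spaces whose norms glue to a continuous
function on the total space, the fiberwise operations are continuous, and the neighborhoods of the
zero vector `0ₓ` are determined by the norm and the projection: `pᵢ → 0ₓ` if and only if
`‖pᵢ‖ → 0` and `π pᵢ → x`. -/
class IsBanachBundle (𝕜 : Type*) [RCLike 𝕜] {X : Type*} [TopologicalSpace X] (E : X → Type*)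
    [∀ x, NormedAddCommGroup (E x)] [∀ x, NormedSpace 𝕜 (E x)]
    [TopologicalSpace (BundleTotal E)] : Prop where
  complete_fiber : ∀ x, CompleteSpace (E x)
  continuous_base : Continuous (BundleTotal.base : BundleTotal E → X)
  isOpenMap_base : IsOpenMap (BundleTotal.base : BundleTotal E → X)
  continuous_norm : Continuous (fun p : BundleTotal E => ‖p.vec‖)
  continuous_add :
    Continuous (fun p : FiberSquare E => (⟨p.base, p.fst + p.snd⟩ : BundleTotal E))
  continuous_smul : ∀ c : 𝕜,
    Continuous (fun p : BundleTotal E => (⟨p.base, c • p.vec⟩ : BundleTotal E))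
  nhds_zero : ∀ x : X, 𝓝 (⟨x, 0⟩ : BundleTotal E) =
    comap (fun p : BundleTotal E => ‖p.vec‖) (𝓝 0) ⊓ comap BundleTotal.base (𝓝 x)

/-- The fiber dimensions are finite and uniformly bounded. -/
def IsSubhomogeneous (𝕜 : Type*) [RCLike 𝕜] {X : Type*} (E : X → Type*)
    [∀ x, NormedAddCommGroup (E x)] [∀ x, NormedSpace 𝕜 (E x)] : Prop :=
  ∃ n : ℕ, ∀ x, Module.rank 𝕜 (E x) ≤ n

/-- Every point has a closed paracompact neighborhood. -/
class LocallyParacompactSpace (X : Type*) [TopologicalSpace X] : Prop where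
  exists_nhds : ∀ x : X, ∃ N ∈ 𝓝 x, IsClosed N ∧ ParacompactSpace N

section Sections

variable (𝕜 : Type*) [RCLike 𝕜] {X : Type*} [TopologicalSpace X] (E : X → Type*)
  [∀ x, NormedAddCommGroup (E x)] [∀ x, NormedSpace 𝕜 (E x)]
  [TopologicalSpace (BundleTotal E)] [IsBanachBundle 𝕜 E]

/-- The normed space `Γ_b(E)` of bounded continuous sections with the supremum norm, as a subspace
of the space `lp E ∞` of all bounded (not necessarily continuous) sections. -/
def BoundedSections : Submodule 𝕜 (lp E ∞) where
  carrier := {s | Continuous (fun x => (⟨x, s x⟩ : BundleTotal E))}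
  add_mem' := by
    intro s t hs ht
    have h : Continuous (fun x => (⟨x, s x, t x⟩ : FiberSquare E)) :=
      continuous_induced_rng.2 (hs.prodMk ht)
    exact (IsBanachBundle.continuous_add (𝕜 := 𝕜)).comp h
  zero_mem' := by
    refine continuous_iff_continuousAt.2 fun x => ?_
    change Tendsto (fun y => (⟨y, 0⟩ : BundleTotal E)) (𝓝 x) (𝓝 (⟨x, 0⟩ : BundleTotal E))
    rw [IsBanachBundle.nhds_zero (𝕜 := 𝕜) x]
    refine tendsto_inf.2 ⟨tendsto_comap_iff.2 ?_, tendsto_comap_iff.2 tendsto_id⟩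
    have : ((fun p : BundleTotal E => ‖p.vec‖) ∘ fun y => (⟨y, 0⟩ : BundleTotal E))
        = fun _ => (0 : ℝ) := by
      funext y; simp
    rw [this]
    exact tendsto_const_nhds
  smul_mem' := by
    intro c s hs
    exact (IsBanachBundle.continuous_smul c).comp hs

end Sections

section Seminorms

variable {𝕜 : Type*} [RCLike 𝕜]

/-- The space `𝒮(V)` of continuous seminorms on `V`. -/
def ContSeminorm (𝕜 : Type*) [RCLike 𝕜] (V : Type*) [NormedAddCommGroup V] [NormedSpace 𝕜 V] :
    Type _ :=
  {p : Seminorm 𝕜 V // Continuous p}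

/-- The pointwise topology on the space of continuous seminorms. -/
instance {V : Type*} [NormedAddCommGroup V] [NormedSpace 𝕜 V] :
    TopologicalSpace (ContSeminorm 𝕜 V) :=
  TopologicalSpace.induced (fun p v => p.1 v) Pi.topologicalSpace

/-- A seminorm is a norm if it vanishes only at `0`. -/
def Seminorm.IsNorm {V : Type*} [AddCommGroup V] [Module 𝕜 V] (q : Seminorm 𝕜 V) : Prop :=
  ∀ v, q v = 0 → v = 0

/-- `q` is the norm induced by some (positive definite) inner product. -/
def Seminorm.IsHilbertNorm {V : Type*} [AddCommGroup V] [Module 𝕜 V] (q : Seminorm 𝕜 V) : Prop :=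
  ∃ c : InnerProductSpace.Core 𝕜 V, ∀ v, q v = Real.sqrt (RCLike.re (c.inner v v))

/-- The `ℓ²` convex combination `(t p² + (1 - t) q²)^(1/2)` of two seminorms, for `t ∈ [0,1]`. -/
noncomputable def Seminorm.l2Comb {V : Type*} [AddCommGroup V] [Module 𝕜 V]
    (t : unitInterval) (p q : Seminorm 𝕜 V) : Seminorm 𝕜 V :=
  Seminorm.of (fun v => Real.sqrt ((t : ℝ) * p v ^ 2 + (1 - (t : ℝ)) * q v ^ 2))
    (by
      intro v w
      have h0 : 0 ≤ (t : ℝ) := t.2.1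
      have h1 : 0 ≤ 1 - (t : ℝ) := sub_nonneg.2 t.2.2
      generalize (t : ℝ) = a at h0 h1
      generalize 1 - a = b at h1
      have hp := map_add_le_add p v w
      have hq := map_add_le_add q v w
      have hp2 : p (v + w) ^ 2 ≤ (p v + p w) ^ 2 := pow_le_pow_left₀ (apply_nonneg p _) hp 2
      have hq2 : q (v + w) ^ 2 ≤ (q v + q w) ^ 2 := pow_le_pow_left₀ (apply_nonneg q _) hq 2
      have hA : 0 ≤ a * p v ^ 2 + b * q v ^ 2 := by positivity
      have hB : 0 ≤ a * p w ^ 2 + b * q w ^ 2 := by positivity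
      have hcs : a * (p v * p w) + b * (q v * q w) ≤
          Real.sqrt (a * p v ^ 2 + b * q v ^ 2) * Real.sqrt (a * p w ^ 2 + b * q w ^ 2) := by
        rw [← Real.sqrt_mul hA]
        apply Real.le_sqrt_of_sq_le
        nlinarith [mul_nonneg (mul_nonneg h0 h1) (sq_nonneg (p v * q w - p w * q v))]
      apply Real.sqrt_le_iff.2
      refine ⟨by positivity, ?_⟩
      rw [add_sq, Real.sq_sqrt hA, Real.sq_sqrt hB]
      have e1 := mul_le_mul_of_nonneg_left hp2 h0
      have e2 := mul_le_mul_of_nonneg_left hq2 h1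
      nlinarith)
    (by
      intro c v
      rw [map_smul_eq_mul, map_smul_eq_mul, mul_pow, mul_pow,
        show (t : ℝ) * (‖c‖ ^ 2 * p v ^ 2) + (1 - (t : ℝ)) * (‖c‖ ^ 2 * q v ^ 2) =
          ‖c‖ ^ 2 * ((t : ℝ) * p v ^ 2 + (1 - (t : ℝ)) * q v ^ 2) by ring,
        Real.sqrt_mul (sq_nonneg _), Real.sqrt_sq (norm_nonneg c)])

/-- Convexity of a set of seminorms for the `ℓ²` convex structure. -/
def IsL2Convex {V : Type*} [AddCommGroup V] [Module 𝕜 V] (S : Set (Seminorm 𝕜 V)) : Prop :=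
  ∀ p ∈ S, ∀ q ∈ S, ∀ t : unitInterval, Seminorm.l2Comb t p q ∈ S

/-- The operator norm of a linear map from `(V, p)` to `(W, q)`; it is `∞` if the map is
unbounded. -/
noncomputable def opNormBetween {V W : Type*} [AddCommGroup V] [Module 𝕜 V] [AddCommGroup W]
    [Module 𝕜 W] (p : Seminorm 𝕜 V) (q : Seminorm 𝕜 W) (T : V →ₗ[𝕜] W) : ℝ≥0∞ :=
  ⨅ (c : ℝ≥0) (_ : ∀ v, q (T v) ≤ c * p v), (c : ℝ≥0∞)

/-- The (multiplicative) Banach–Mazur distance between `(V, p)` and `(W, q)`. -/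
noncomputable def banachMazurDist {V W : Type*} [AddCommGroup V] [Module 𝕜 V] [AddCommGroup W]
    [Module 𝕜 W] (p : Seminorm 𝕜 V) (q : Seminorm 𝕜 W) : ℝ≥0∞ :=
  ⨅ T : V ≃ₗ[𝕜] W, opNormBetween p q (T : V →ₗ[𝕜] W) * opNormBetween q p (T.symm : W →ₗ[𝕜] V)

end Seminorms

section Renorming

variable {𝕜 : Type*} [RCLike 𝕜] {X : Type*} {E : X → Type*}
  [∀ x, NormedAddCommGroup (E x)] [∀ x, NormedSpace 𝕜 (E x)]

/-- `K` assigns to every point `x` a set of norms on the fiber `E x`, in such a way that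

* the Banach–Mazur distances from the original fibers are uniformly bounded;
* the norms in `K x` are equivalent to the original ones, with constants uniform over all `x`
  and all members of `K x`. -/
structure IsEquivalentMultiRenorming (K : ∀ x, Set (Seminorm 𝕜 (E x))) : Prop where
  isNorm : ∀ x, ∀ q ∈ K x, q.IsNorm
  banachMazur_bdd : ⨆ x, ⨆ q ∈ K x, banachMazurDist (normSeminorm 𝕜 (E x)) q < ∞
  equivalent : ∃ C : ℝ, 0 < C ∧ ∀ x, ∀ q ∈ K x, ∀ v : E x, q v ≤ C * ‖v‖ ∧ ‖v‖ ≤ C * q v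

/-- The set of seminorms `s ↦ q (s x)` on the space of bounded sections, for `q ∈ K x`. -/
def inducedSeminorms [TopologicalSpace X] [TopologicalSpace (BundleTotal E)] [IsBanachBundle 𝕜 E]
    (K : ∀ x, Set (Seminorm 𝕜 (E x))) (x : X) : Set (ContSeminorm 𝕜 (BoundedSections 𝕜 E)) :=
  {p | ∃ q ∈ K x, ∀ s : BoundedSections 𝕜 E, p.1 s = q ((s : lp E ∞) x)}

end Renorming

/-! Let F_x ⊆ E_x be the space of values at x of bounded continuous sections; the induced seminorms
see only F_x. Let K_x consist of the Hilbert norms on E_x that are B-equivalent to the given norm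
and, on F_x, C(dim F_x)-equivalent to it, where C grows by a factor A² with each dimension. Here A
bounds the distortion of suitable Euclidean coordinates on all fibers (`exists_euclidean_bound`).

The difficulty is lower semicontinuity. Lift F_x to a finite-dimensional space W of sections. Near
x, evaluation on W is almost isometric to evaluation at x, so a norm q on F_x can be carried to the
image of W in F_y. If q satisfies its bound strictly, the slack absorbs the distortion. If dim F_y =
dim F_x, the image is all of F_y and the bound survives. Otherwise dim F_y is larger, and extending
the norm orthogonally (`Seminorm.exists_extension`) costs A², which C(dim F_y) allows. Strictness is
free: an ℓ² mixture of q with a Euclidean norm of constant A < C(dim F_x) has a better constant and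
tends to q (`EquivOn.exists_lt_l2Comb`).

Convexity follows by working with squares of norms. Closedness follows from compactness of K_x in
the pointwise topology. -/

namespace Seminorm

/-! ### Parallelogram seminorms and ℓ² mixing -/

variable {𝕜 : Type*} [RCLike 𝕜] {V : Type*}

/-- The parallelogram identity for a seminorm. -/
def IsParallelogram [AddCommGroup V] [Module 𝕜 V] (q : Seminorm 𝕜 V) : Prop :=
  ∀ v w, q (v + w) ^ 2 + q (v - w) ^ 2 = 2 * (q v ^ 2 + q w ^ 2)

/-- A seminorm which is equivalent to the given norm on a set, with constant `C`. -/
def EquivOn [NormedAddCommGroup V] [NormedSpace 𝕜 V] (C : ℝ) (S : Set V) (q : Seminorm 𝕜 V) :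
    Prop :=
  ∀ v ∈ S, q v ≤ C * ‖v‖ ∧ ‖v‖ ≤ C * q v

/-- Jordan–von Neumann: a norm satisfying the parallelogram identity is a Hilbert norm. -/
theorem IsParallelogram.isHilbertNorm [AddCommGroup V] [Module 𝕜 V] {q : Seminorm 𝕜 V}
    (hq : q.IsParallelogram) (h0 : q.IsNorm) : q.IsHilbertNorm := by
  let _ : NormedAddCommGroup V := AddGroupNorm.toNormedAddCommGroup
    { q.toAddGroupSeminorm with eq_zero_of_map_eq_zero' := fun v hv => h0 v hv }
  have hn : ∀ v : V, ‖v‖ = q v := fun _ => rfl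
  let _ : NormedSpace 𝕜 V := ⟨fun c v => (map_smul_eq_mul q c v).le⟩
  let ip : InnerProductSpace 𝕜 V := InnerProductSpace.ofNorm 𝕜 fun v w => by
    have := hq v w
    simp only [hn]
    linarith
  refine ⟨@InnerProductSpace.toCore 𝕜 V _ _ ip, fun v => ?_⟩
  rw [← hn]
  exact @norm_eq_sqrt_re_inner 𝕜 V _ _ ip v

theorem l2Comb_apply [AddCommGroup V] [Module 𝕜 V] (t : unitInterval) (p q : Seminorm 𝕜 V)
    (v : V) : l2Comb t p q v = Real.sqrt ((t : ℝ) * p v ^ 2 + (1 - (t : ℝ)) * q v ^ 2) := rfl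

theorem l2Comb_sq [AddCommGroup V] [Module 𝕜 V] (t : unitInterval) (p q : Seminorm 𝕜 V)
    (v : V) : l2Comb t p q v ^ 2 = (t : ℝ) * p v ^ 2 + (1 - (t : ℝ)) * q v ^ 2 := by
  have h0 : 0 ≤ (t : ℝ) := t.2.1
  have h1 : 0 ≤ 1 - (t : ℝ) := sub_nonneg.2 t.2.2
  rw [l2Comb_apply, Real.sq_sqrt (by positivity)]

theorem IsParallelogram.l2Comb [AddCommGroup V] [Module 𝕜 V] {p q : Seminorm 𝕜 V}
    (hp : p.IsParallelogram) (hq : q.IsParallelogram) (t : unitInterval) :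
    (l2Comb t p q).IsParallelogram := by
  intro v w
  simp only [l2Comb_sq]
  linear_combination (t : ℝ) * hp v w + (1 - (t : ℝ)) * hq v w

theorem IsParallelogram.comp {W : Type*} [AddCommGroup V] [Module 𝕜 V] [AddCommGroup W]
    [Module 𝕜 W] {p : Seminorm 𝕜 V} (hp : p.IsParallelogram) (T : W →ₗ[𝕜] V) :
    (p.comp T).IsParallelogram := by
  intro v w
  simpa using hp (T v) (T w)

theorem IsParallelogram.smul [AddCommGroup V] [Module 𝕜 V] {p : Seminorm 𝕜 V}
    (hp : p.IsParallelogram) (r : ℝ≥0) : (r • p).IsParallelogram := by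
  intro v w
  simp only [smul_apply, NNReal.smul_def, smul_eq_mul, mul_pow]
  linear_combination (r : ℝ) ^ 2 * hp v w

theorem isParallelogram_normSeminorm [NormedAddCommGroup V] [InnerProductSpace 𝕜 V] :
    (normSeminorm 𝕜 V).IsParallelogram := by
  intro v w
  simp only [coe_normSeminorm]
  have := parallelogram_law_with_norm 𝕜 v w
  linarith

/-- An `ℓ²` combination is equivalent to the norm, with constants interpolating between those
of the two given seminorms. -/
theorem EquivOn.l2Comb_of_sq_le [NormedAddCommGroup V] [NormedSpace 𝕜 V] {p q : Seminorm 𝕜 V}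
    {a b C : ℝ} {S : Set V} (ha : 0 < a) (hb : 0 < b) (hC : 0 < C) (hp : EquivOn a S p)
    (hq : EquivOn b S q)
    {t : unitInterval} (h1 : t * a ^ 2 + (1 - t) * b ^ 2 ≤ C ^ 2)
    (h2 : 1 / C ^ 2 ≤ t * (1 / a ^ 2) + (1 - t) * (1 / b ^ 2)) :
    EquivOn C S (l2Comb t p q) := by
  intro v hv
  have t0 : 0 ≤ (t : ℝ) := t.2.1
  have t1 : 0 ≤ 1 - (t : ℝ) := sub_nonneg.2 t.2.2
  obtain ⟨p1, p2⟩ := hp v hv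
  obtain ⟨q1, q2⟩ := hq v hv
  have P1 : p v ^ 2 ≤ a ^ 2 * ‖v‖ ^ 2 := by
    rw [← mul_pow]; exact pow_le_pow_left₀ (apply_nonneg p _) p1 2
  have Q1 : q v ^ 2 ≤ b ^ 2 * ‖v‖ ^ 2 := by
    rw [← mul_pow]; exact pow_le_pow_left₀ (apply_nonneg q _) q1 2
  have P2 : 1 / a ^ 2 * ‖v‖ ^ 2 ≤ p v ^ 2 := by
    rw [one_div, inv_mul_le_iff₀ (by positivity), ← mul_pow]
    exact pow_le_pow_left₀ (norm_nonneg _) p2 2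
  have Q2 : 1 / b ^ 2 * ‖v‖ ^ 2 ≤ q v ^ 2 := by
    rw [one_div, inv_mul_le_iff₀ (by positivity), ← mul_pow]
    exact pow_le_pow_left₀ (norm_nonneg _) q2 2
  constructor
  · refine le_of_sq_le_sq ?_ (by positivity)
    rw [l2Comb_sq, mul_pow]
    calc _ ≤ t * (a ^ 2 * ‖v‖ ^ 2) + (1 - t) * (b ^ 2 * ‖v‖ ^ 2) := by gcongr
      _ = (t * a ^ 2 + (1 - t) * b ^ 2) * ‖v‖ ^ 2 := by ring
      _ ≤ _ := by gcongr
  · refine le_of_sq_le_sq ?_ (mul_nonneg hC.le (apply_nonneg _ _))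
    rw [mul_pow, l2Comb_sq, ← inv_mul_le_iff₀ (by positivity), ← one_div]
    calc _ ≤ (t * (1 / a ^ 2) + (1 - t) * (1 / b ^ 2)) * ‖v‖ ^ 2 := by gcongr
      _ = t * (1 / a ^ 2 * ‖v‖ ^ 2) + (1 - t) * (1 / b ^ 2 * ‖v‖ ^ 2) := by ring
      _ ≤ _ := by gcongr

theorem EquivOn.l2Comb [NormedAddCommGroup V] [NormedSpace 𝕜 V] {p q : Seminorm 𝕜 V}
    {C : ℝ} {S : Set V} (hC : 0 < C) (hp : EquivOn C S p) (hq : EquivOn C S q)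
    (t : unitInterval) : EquivOn C S (l2Comb t p q) :=
  hp.l2Comb_of_sq_le hC hC hC hq (le_of_eq (by ring)) (le_of_eq (by ring))

theorem EquivOn.mono [NormedAddCommGroup V] [NormedSpace 𝕜 V] {q : Seminorm 𝕜 V}
    {C D : ℝ} {S S' : Set V} (h : EquivOn C S q) (hCD : C ≤ D) (hS : S' ⊆ S) :
    EquivOn D S' q := fun v hv =>
  ⟨(h v (hS hv)).1.trans (by gcongr),
    (h v (hS hv)).2.trans (mul_le_mul_of_nonneg_right hCD (apply_nonneg _ _))⟩

/-- Mixing with a seminorm with a better constant improves the constant. -/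
theorem EquivOn.exists_lt_l2Comb [NormedAddCommGroup V] [NormedSpace 𝕜 V] {p q : Seminorm 𝕜 V}
    {a b : ℝ} {S : Set V} (ha : 0 < a) (hab : a < b) (hp : EquivOn b S p) (hq : EquivOn a S q)
    {t : unitInterval} (ht : t < 1) : ∃ c, 0 < c ∧ c < b ∧ EquivOn c S (Seminorm.l2Comb t p q) := by
  have hb := ha.trans hab
  have t0 : 0 ≤ (t : ℝ) := t.2.1
  have t1 : 0 < 1 - (t : ℝ) := sub_pos.2 ht
  have H1 : t * b ^ 2 + (1 - t) * a ^ 2 < b ^ 2 := by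
    have : a ^ 2 < b ^ 2 := by gcongr
    nlinarith
  have H2 : 1 / b ^ 2 < t * (1 / b ^ 2) + (1 - t) * (1 / a ^ 2) := by
    have : 1 / b ^ 2 < 1 / a ^ 2 := by gcongr
    nlinarith
  -- Both strict inequalities hold at c = b and are open in c, so they persist for some c just below
  -- b.
  have e1 : ∀ᶠ c in 𝓝 b, t * b ^ 2 + (1 - t) * a ^ 2 < c ^ 2 :=
    (by fun_prop : ContinuousAt (fun c : ℝ => c ^ 2) b).eventually (lt_mem_nhds H1)
  have e2 : ∀ᶠ c in 𝓝 b, 1 / c ^ 2 < t * (1 / b ^ 2) + (1 - t) * (1 / a ^ 2) :=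
    (ContinuousAt.div continuousAt_const (by fun_prop) (by positivity) :
      ContinuousAt (fun c : ℝ => 1 / c ^ 2) b).eventually (gt_mem_nhds H2)
  obtain ⟨c, ⟨⟨h1, h2⟩, h3⟩, h4⟩ :=
    (((e1.and e2).and (lt_mem_nhds hb)).filter_mono nhdsWithin_le_nhds |>.and
      (self_mem_nhdsWithin : Set.Iio b ∈ 𝓝[<] b)).exists
  exact ⟨c, h3, h4, hp.l2Comb_of_sq_le hb ha h3 hq h1.le h2.le⟩

end Seminorm

/-! ### Uniform Euclidean coordinates -/

/-- Finite-dimensional normed spaces of a given dimension are uniformly isomorphic to a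
coordinate space. -/
theorem exists_coordinates_bound.{u} (𝕜 : Type*) [RCLike 𝕜] (d : ℕ) :
    ∃ A : ℝ, 0 ≤ A ∧ ∀ (V : Type u) [NormedAddCommGroup V] [NormedSpace 𝕜 V]
      [FiniteDimensional 𝕜 V], Module.finrank 𝕜 V = d →
      ∃ T : V →ₗ[𝕜] (Fin d → 𝕜), ∀ v, ‖v‖ ≤ A * ‖T v‖ ∧ ‖T v‖ ≤ A * ‖v‖ := by
  induction d with
  | zero =>
    refine ⟨1, zero_le_one, fun V _ _ _ h => ⟨0, fun v => ?_⟩⟩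
    have := Module.finrank_zero_iff.1 h
    simp [Subsingleton.elim v 0]
  | succ d ih =>
    obtain ⟨A, hA, ih⟩ := ih
    refine ⟨max (1 + A) (1 + A * 2), by positivity, fun V _ _ _ h => ?_⟩
    have _ : Nontrivial V := Module.nontrivial_of_finrank_pos (R := 𝕜) (by omega)
    obtain ⟨e₀, he₀⟩ := exists_norm_ne_zero V
    have he₀' : e₀ ≠ 0 := norm_ne_zero_iff.1 he₀
    -- A functional norming e splits V into the line of e and ker f. The projection onto ker f has
    -- norm at most 2 whatever V is, so the constant depends on the dimension alone.
    obtain ⟨f, hf, hfe⟩ := exists_dual_vector 𝕜 e₀ he₀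
    set e : V := ((‖e₀‖ : 𝕜)⁻¹) • e₀ with he
    have hne : ‖e‖ = 1 := by
      rw [he, norm_smul, norm_inv, RCLike.norm_ofReal, abs_norm, inv_mul_cancel₀ he₀]
    have hfe1 : f e = 1 := by
      rw [he, map_smul, hfe, smul_eq_mul, inv_mul_cancel₀]
      exact_mod_cast he₀
    have hker : Module.finrank 𝕜 (LinearMap.ker (f : V →ₗ[𝕜] 𝕜)) = d := by
      have h1 := LinearMap.finrank_range_add_finrank_ker (f : V →ₗ[𝕜] 𝕜)
      have h2 : LinearMap.range (f : V →ₗ[𝕜] 𝕜) = ⊤ :=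
        LinearMap.range_eq_top.2 fun c => ⟨c • e, by simp [hfe1]⟩
      rw [h2, finrank_top, Module.finrank_self] at h1
      omega
    obtain ⟨T, hT⟩ := ih (LinearMap.ker (f : V →ₗ[𝕜] 𝕜)) hker
    let P : V →ₗ[𝕜] LinearMap.ker (f : V →ₗ[𝕜] 𝕜) :=
      (LinearMap.id - (f : V →ₗ[𝕜] 𝕜).smulRight e).codRestrict _ fun v => by
        simp [hfe1]
    have hP : ∀ v, (P v : V) = v - f v • e := fun v => rfl
    have hfv : ∀ v, ‖f v‖ ≤ ‖v‖ := fun v => by simpa [hf] using f.le_opNorm v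
    have hPv : ∀ v, ‖P v‖ ≤ 2 * ‖v‖ := fun v => by
      rw [← Submodule.norm_coe, hP]
      calc _ ≤ ‖v‖ + ‖f v • e‖ := norm_sub_le _ _
        _ ≤ ‖v‖ + ‖v‖ := by rw [norm_smul, hne, mul_one]; gcongr; exact hfv v
        _ = _ := by ring
    let S : V →ₗ[𝕜] (Fin (d + 1) → 𝕜) :=
      LinearMap.pi (Fin.cons (f : V →ₗ[𝕜] 𝕜) fun i => LinearMap.proj i ∘ₗ T ∘ₗ P)
    have S0 : ∀ v, S v 0 = f v := fun v => rfl
    have Ss : ∀ v i, S v (Fin.succ i) = T (P v) i := fun v i => rfl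
    refine ⟨S, fun v => ⟨?_, ?_⟩⟩
    · have h1 : ‖f v‖ ≤ ‖S v‖ := S0 v ▸ norm_le_pi_norm (S v) 0
      have h2 : ‖T (P v)‖ ≤ ‖S v‖ :=
        (pi_norm_le_iff_of_nonneg (norm_nonneg _)).2 fun i => Ss v i ▸ norm_le_pi_norm (S v) _
      calc ‖v‖ = ‖f v • e + (P v : V)‖ := by rw [hP]; congr 1; abel
        _ ≤ ‖f v • e‖ + ‖(P v : V)‖ := norm_add_le _ _
        _ ≤ ‖f v‖ + A * ‖T (P v)‖ := by
            rw [norm_smul, hne, mul_one]; gcongr; exact (hT (P v)).1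
        _ ≤ ‖S v‖ + A * ‖S v‖ := by gcongr
        _ = (1 + A) * ‖S v‖ := by ring
        _ ≤ _ := by gcongr; exact le_max_left _ _
    · refine le_trans ?_ (mul_le_mul_of_nonneg_right (le_max_right _ _) (norm_nonneg v))
      refine (pi_norm_le_iff_of_nonneg (by positivity)).2 fun i => ?_
      refine Fin.cases ?_ (fun i => ?_) i
      · rw [S0]
        have := hfv v
        have : 0 ≤ A * 2 * ‖v‖ := by positivity
        linarith
      · rw [Ss]
        calc _ ≤ ‖T (P v)‖ := norm_le_pi_norm _ i
          _ ≤ A * ‖P v‖ := (hT _).2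
          _ ≤ A * (2 * ‖v‖) := by gcongr; exact hPv v
          _ ≤ _ := by linarith [norm_nonneg v]

/-- Finite-dimensional normed spaces of bounded dimension are uniformly isomorphic to
Euclidean spaces. -/
theorem exists_euclidean_bound.{u} (𝕜 : Type*) [RCLike 𝕜] (n : ℕ) :
    ∃ A : ℝ, 1 ≤ A ∧ ∀ (V : Type u) [NormedAddCommGroup V] [NormedSpace 𝕜 V]
      [FiniteDimensional 𝕜 V], Module.finrank 𝕜 V ≤ n →
      ∃ (d : ℕ) (T : V →ₗ[𝕜] EuclideanSpace 𝕜 (Fin d)),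
        ∀ v, ‖v‖ ≤ A * ‖T v‖ ∧ ‖T v‖ ≤ A * ‖v‖ := by
  have key : ∀ d : ℕ, ∃ A : ℝ, 0 ≤ A ∧ ∀ (V : Type u) [NormedAddCommGroup V] [NormedSpace 𝕜 V]
      [FiniteDimensional 𝕜 V], Module.finrank 𝕜 V = d →
      ∃ T : V →ₗ[𝕜] EuclideanSpace 𝕜 (Fin d), ∀ v, ‖v‖ ≤ A * ‖T v‖ ∧ ‖T v‖ ≤ A * ‖v‖ := by
    intro d
    obtain ⟨A, hA, h⟩ := exists_coordinates_bound.{u} 𝕜 d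
    let Φ := EuclideanSpace.equiv (Fin d) 𝕜
    set a := ‖(Φ : EuclideanSpace 𝕜 (Fin d) →L[𝕜] (Fin d → 𝕜))‖
    set b := ‖(Φ.symm : (Fin d → 𝕜) →L[𝕜] EuclideanSpace 𝕜 (Fin d))‖
    have ha : 0 ≤ a := norm_nonneg _
    have hb : 0 ≤ b := norm_nonneg _
    refine ⟨A * a + b * A, by positivity, fun V _ _ _ hV => ?_⟩
    obtain ⟨T, hT⟩ := h V hV
    refine ⟨(Φ.symm : (Fin d → 𝕜) →ₗ[𝕜] EuclideanSpace 𝕜 (Fin d)) ∘ₗ T, fun v => ?_⟩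
    change ‖v‖ ≤ _ * ‖Φ.symm (T v)‖ ∧ ‖Φ.symm (T v)‖ ≤ _
    have h1 : ‖T v‖ ≤ a * ‖Φ.symm (T v)‖ := by
      have := (Φ : EuclideanSpace 𝕜 (Fin d) →L[𝕜] (Fin d → 𝕜)).le_opNorm (Φ.symm (T v))
      simpa using this
    have h2 : ‖Φ.symm (T v)‖ ≤ b * ‖T v‖ :=
      (Φ.symm : (Fin d → 𝕜) →L[𝕜] EuclideanSpace 𝕜 (Fin d)).le_opNorm (T v)
    constructor
    · calc ‖v‖ ≤ A * ‖T v‖ := (hT v).1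
        _ ≤ A * (a * ‖Φ.symm (T v)‖) := by gcongr
        _ = A * a * ‖Φ.symm (T v)‖ := by ring
        _ ≤ _ := by gcongr; exact le_add_of_nonneg_right (by positivity)
    · calc _ ≤ b * ‖T v‖ := h2
        _ ≤ b * (A * ‖v‖) := by gcongr; exact (hT v).2
        _ = b * A * ‖v‖ := by ring
        _ ≤ _ := by gcongr; exact le_add_of_nonneg_left (by positivity)
  choose A hA h using key
  have hsum : ∀ d ≤ n, A d ≤ 1 + ∑ i ∈ Finset.range (n + 1), A i := fun d hd =>
    (Finset.single_le_sum (fun i _ => hA i) (Finset.mem_range.2 (Nat.lt_succ_of_le hd))).trans (by simp)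
  -- The sum serves all dimensions up to n at once; the summand 1 ensures 1 ≤ A.
  refine ⟨1 + ∑ i ∈ Finset.range (n + 1), A i,
    le_add_of_nonneg_right (Finset.sum_nonneg fun i _ => hA i), fun V _ _ _ hV => ?_⟩
  obtain ⟨T, hT⟩ := h _ V rfl
  exact ⟨_, T, fun v => ⟨(hT v).1.trans (by gcongr; exact hsum _ hV),
    (hT v).2.trans (by gcongr; exact hsum _ hV)⟩⟩

/-! ### Extension of Hilbert norms -/

/-- Extension of a Hilbert seminorm along an injection into a nearly Euclidean space. -/
theorem Seminorm.exists_extension {𝕜 : Type*} [RCLike 𝕜] {W V : Type*} [AddCommGroup W]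
    [Module 𝕜 W] [NormedAddCommGroup V] [NormedSpace 𝕜 V] {d : ℕ}
    (T : V →ₗ[𝕜] EuclideanSpace 𝕜 (Fin d)) {A c : ℝ} (hA : 1 ≤ A) (hc : 1 ≤ c)
    (hT : ∀ v, ‖v‖ ≤ A * ‖T v‖ ∧ ‖T v‖ ≤ A * ‖v‖) (L : W →ₗ[𝕜] V)
    (hL : Function.Injective L) (p : Seminorm 𝕜 W) (hp : p.IsParallelogram)
    (h : ∀ w, p w ≤ c * ‖L w‖ ∧ ‖L w‖ ≤ c * p w) :
    ∃ q : Seminorm 𝕜 V, q.IsParallelogram ∧ (∀ w, q (L w) = p w) ∧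
      q.EquivOn (A ^ 2 * c) Set.univ := by
  have hTinj : Function.Injective T := (injective_iff_map_eq_zero T).2 fun v hv => by
    have := (hT v).1
    rw [hv, norm_zero, mul_zero] at this
    exact norm_le_zero_iff.1 this
  let J : W →ₗ[𝕜] EuclideanSpace 𝕜 (Fin d) := T ∘ₗ L
  have hJ : Function.Injective J := hTinj.comp hL
  let U := LinearMap.range J
  let e : W ≃ₗ[𝕜] U := LinearEquiv.ofInjective J hJ
  -- R is the retraction of L given by orthogonal projection in coordinates. The extension has
  -- square p(R v)² + ‖Q v‖², to be compared with ‖T v‖² by Pythagoras.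
  let R : V →ₗ[𝕜] W := (e.symm : U →ₗ[𝕜] W) ∘ₗ (U.orthogonalProjectionOnto : _ →ₗ[𝕜] U) ∘ₗ T
  have hJR : ∀ v, J (R v) = U.starProjection (T v) := fun v => by
    change ((e (e.symm (U.orthogonalProjectionOnto (T v))) : U) : EuclideanSpace 𝕜 (Fin d)) = _
    rw [LinearEquiv.apply_symm_apply]; rfl
  have hRL : ∀ w, R (L w) = w := fun w => hJ <| by
    rw [hJR]
    exact Submodule.starProjection_eq_self_iff.2 ⟨w, rfl⟩
  let Q : V →ₗ[𝕜] EuclideanSpace 𝕜 (Fin d) := T - J ∘ₗ R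
  have hQ : ∀ v, Q v = T v - J (R v) := fun v => rfl
  have hpyth : ∀ v, ‖T v‖ ^ 2 = ‖J (R v)‖ ^ 2 + ‖Q v‖ ^ 2 := fun v => by
    rw [hQ, hJR, Submodule.norm_sq_eq_add_norm_sq_starProjection (T v) U]
    congr 3
    simp [Submodule.starProjection_orthogonal]
  -- Scaling by √2 cancels the weights 1/2, so that an ℓ² combination yields a plain sum of squares.
  let r : ℝ≥0 := NNReal.sqrt 2
  have hr : (r : ℝ) ^ 2 = 2 := by
    simp [r]
  let half : unitInterval := ⟨1 / 2, by norm_num, by norm_num⟩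
  let q : Seminorm 𝕜 V := Seminorm.l2Comb half (r • p.comp R)
    (r • (normSeminorm 𝕜 (EuclideanSpace 𝕜 (Fin d))).comp Q)
  have hq : ∀ v, q v ^ 2 = p (R v) ^ 2 + ‖Q v‖ ^ 2 := fun v => by
    simp only [q, Seminorm.l2Comb_sq, half, smul_apply, NNReal.smul_def, smul_eq_mul,
      mul_pow, hr, Seminorm.comp_apply, coe_normSeminorm]
    ring
  -- One factor A is lost between ‖L w‖ and ‖J w‖, another between ‖v‖ and ‖T v‖: hence A² c. The
  -- term ‖Q v‖² is carried along since 1 ≤ A c.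
  have hAc : 1 ≤ A * c := one_le_mul_of_one_le_of_one_le hA hc
  have hp1 : ∀ w, p w ^ 2 ≤ (A * c) ^ 2 * ‖J w‖ ^ 2 := fun w => by
    rw [← mul_pow]
    refine pow_le_pow_left₀ (apply_nonneg p _) ?_ 2
    calc p w ≤ c * ‖L w‖ := (h w).1
      _ ≤ c * (A * ‖J w‖) := by gcongr; exact (hT _).1
      _ = _ := by ring
  have hp2 : ∀ w, ‖J w‖ ^ 2 ≤ (A * c) ^ 2 * p w ^ 2 := fun w => by
    rw [← mul_pow]
    refine pow_le_pow_left₀ (norm_nonneg _) ?_ 2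
    calc ‖J w‖ ≤ A * ‖L w‖ := (hT _).2
      _ ≤ A * (c * p w) := by gcongr; exact (h w).2
      _ = _ := by ring
  have hAc2 : 1 ≤ (A * c) ^ 2 := one_le_pow₀ hAc
  refine ⟨q, ?_, fun w => ?_, fun v _ => ⟨?_, ?_⟩⟩
  · exact ((hp.comp R).smul r).l2Comb ((isParallelogram_normSeminorm.comp Q).smul r) half
  · have := hq (L w)
    have hz : Q (L w) = 0 := by rw [hQ, hRL]; exact sub_self _
    rw [hRL, hz, norm_zero, zero_pow two_ne_zero, add_zero] at this
    exact (sq_eq_sq₀ (apply_nonneg q _) (apply_nonneg p _)).1 this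
  · refine le_of_sq_le_sq ?_ (by positivity)
    calc q v ^ 2 = p (R v) ^ 2 + ‖Q v‖ ^ 2 := hq v
      _ ≤ (A * c) ^ 2 * ‖J (R v)‖ ^ 2 + (A * c) ^ 2 * ‖Q v‖ ^ 2 :=
          add_le_add (hp1 _) (le_mul_of_one_le_left (sq_nonneg _) hAc2)
      _ = (A * c) ^ 2 * ‖T v‖ ^ 2 := by rw [hpyth]; ring
      _ ≤ (A * c) ^ 2 * (A * ‖v‖) ^ 2 := by gcongr; exact (hT v).2
      _ = _ := by ring
  · refine le_of_sq_le_sq ?_ (mul_nonneg (by positivity) (apply_nonneg q _))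
    calc ‖v‖ ^ 2 ≤ (A * ‖T v‖) ^ 2 := by gcongr; exact (hT v).1
      _ = A ^ 2 * (‖J (R v)‖ ^ 2 + ‖Q v‖ ^ 2) := by rw [← hpyth]; ring
      _ ≤ A ^ 2 * ((A * c) ^ 2 * p (R v) ^ 2 + (A * c) ^ 2 * ‖Q v‖ ^ 2) := by
          gcongr
          · exact hp2 _
          · exact le_mul_of_one_le_left (sq_nonneg _) hAc2
      _ = (A ^ 2 * c * q v) ^ 2 := by rw [mul_pow _ (q v), hq]; ring

/-- A seminorm equivalent to the norm on the whole space has bounded Banach–Mazur distance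
to it. -/
theorem Seminorm.EquivOn.banachMazurDist_le {𝕜 : Type*} [RCLike 𝕜] {V : Type*}
    [NormedAddCommGroup V] [NormedSpace 𝕜 V] {q : Seminorm 𝕜 V} {C : ℝ≥0}
    (h : q.EquivOn C Set.univ) : banachMazurDist (normSeminorm 𝕜 V) q ≤ C * C := by
  refine (iInf_le _ (LinearEquiv.refl 𝕜 V)).trans (mul_le_mul' ?_ ?_)
  · exact iInf₂_le C fun v => (h v trivial).1
  · exact iInf₂_le C fun v => (h v trivial).2

/-! ### Sections and their evaluation -/

namespace BoundedSections

variable (𝕜 : Type*) [RCLike 𝕜] {X : Type*} [TopologicalSpace X] (E : X → Type*)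
  [∀ x, NormedAddCommGroup (E x)] [∀ x, NormedSpace 𝕜 (E x)]
  [TopologicalSpace (BundleTotal E)] [IsBanachBundle 𝕜 E]

/-- Evaluation of bounded continuous sections at a point. -/
noncomputable def eval (x : X) : BoundedSections 𝕜 E →ₗ[𝕜] E x :=
  lp.evalₗ (𝕜 := 𝕜) E ∞ x ∘ₗ (BoundedSections 𝕜 E).subtype

/-- The vectors in the fiber over `x` which are values of bounded continuous sections. -/
noncomputable def values (x : X) : Submodule 𝕜 (E x) := LinearMap.range (eval 𝕜 E x)

variable {𝕜 E}

theorem eval_apply (x : X) (s : BoundedSections 𝕜 E) : eval 𝕜 E x s = (s : lp E ∞) x := rfl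

theorem norm_eval_le (x : X) (s : BoundedSections 𝕜 E) : ‖eval 𝕜 E x s‖ ≤ ‖s‖ :=
  lp.norm_apply_le_norm ENNReal.top_ne_zero (s : lp E ∞) x

theorem continuous_norm_eval (s : BoundedSections 𝕜 E) :
    Continuous fun x => ‖eval 𝕜 E x s‖ :=
  (IsBanachBundle.continuous_norm (𝕜 := 𝕜) (E := E)).comp s.2

/-- Evaluation is 1-Lipschitz in the section, uniformly in the point. This turns separate continuity
into the joint continuity that the compactness argument on spheres needs. -/
theorem continuous_norm_eval_uncurry :
    Continuous fun p : BoundedSections 𝕜 E × X => ‖eval 𝕜 E p.2 p.1‖ := by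
  rw [continuous_iff_continuousAt]
  rintro ⟨s, x⟩
  rw [ContinuousAt, tendsto_iff_dist_tendsto_zero]
  have h : Tendsto (fun p : BoundedSections 𝕜 E × X =>
      ‖p.1 - s‖ + dist ‖eval 𝕜 E p.2 s‖ ‖eval 𝕜 E x s‖) (𝓝 (s, x)) (𝓝 0) := by
    have hc : Continuous fun p : BoundedSections 𝕜 E × X =>
        ‖p.1 - s‖ + dist ‖eval 𝕜 E p.2 s‖ ‖eval 𝕜 E x s‖ :=
      (continuous_fst.sub continuous_const).norm.add
        (((continuous_norm_eval s).comp continuous_snd).dist continuous_const)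
    simpa using hc.tendsto (s, x)
  refine squeeze_zero (fun _ => dist_nonneg) (fun p => ?_) h
  refine (dist_triangle _ ‖eval 𝕜 E p.2 s‖ _).trans (add_le_add_left ?_ _)
  calc dist ‖eval 𝕜 E p.2 p.1‖ ‖eval 𝕜 E p.2 s‖
      ≤ ‖eval 𝕜 E p.2 p.1 - eval 𝕜 E p.2 s‖ := abs_norm_sub_norm_le _ _
    _ = ‖eval 𝕜 E p.2 (p.1 - s)‖ := by rw [map_sub]
    _ ≤ _ := norm_eval_le _ _

/-- On a finite-dimensional space of sections evaluating injectively at `x`, evaluation at nearby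
points is nearly isometric to evaluation at `x`. -/
theorem eventually_norm_eval_le (W : Submodule 𝕜 (BoundedSections 𝕜 E)) [FiniteDimensional 𝕜 W]
    {x : X} (hW : ∀ w ∈ W, eval 𝕜 E x w = 0 → w = 0) {ρ : ℝ} (hρ : 1 < ρ) :
    ∀ᶠ y in 𝓝 x, ∀ w ∈ W, ‖eval 𝕜 E y w‖ ≤ ρ * ‖eval 𝕜 E x w‖ ∧
      ‖eval 𝕜 E x w‖ ≤ ρ * ‖eval 𝕜 E y w‖ := by
  have : ProperSpace W := FiniteDimensional.proper_rclike 𝕜 W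
  have hc : Continuous fun p : X × W => ‖eval 𝕜 E p.1 p.2‖ :=
    continuous_norm_eval_uncurry.comp
      ((continuous_subtype_val.comp continuous_snd).prodMk continuous_fst)
  have hcx : Continuous fun p : X × W => ‖eval 𝕜 E x p.2‖ :=
    continuous_norm_eval_uncurry.comp
      ((continuous_subtype_val.comp continuous_snd).prodMk continuous_const)
  -- Injectivity at x makes both inequalities strict on the unit sphere of W at y = x; compactness
  -- gives one neighborhood valid for the whole sphere.
  have key := (isCompact_sphere (0 : W) 1).eventually_forall_of_forall_eventually (x₀ := x)
    (P := fun y w => ‖eval 𝕜 E y w‖ < ρ * ‖eval 𝕜 E x w‖ ∧ ‖eval 𝕜 E x w‖ < ρ * ‖eval 𝕜 E y w‖)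
    (fun w hw => by
      have hpos : 0 < ‖eval 𝕜 E x w‖ := norm_pos_iff.2 fun h0 => by
        have : w = 0 := Subtype.ext (hW w w.2 h0)
        simp [this] at hw
      have hlt : ‖eval 𝕜 E x w‖ < ρ * ‖eval 𝕜 E x w‖ := lt_mul_of_one_lt_left hpos hρ
      exact (hc.continuousAt.eventually_lt (hcx.const_mul ρ).continuousAt hlt).and
        (hcx.continuousAt.eventually_lt (hc.const_mul ρ).continuousAt hlt))
  filter_upwards [key] with y hy w hw
  by_cases h0 : w = 0
  · simp [h0]
  have hw0 : 0 < ‖w‖ := norm_pos_iff.2 h0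
  set c : 𝕜 := (‖w‖ : 𝕜)⁻¹ with hc'
  have hcn : ‖c‖ = ‖w‖⁻¹ := by rw [hc', norm_inv, RCLike.norm_ofReal, abs_norm]
  have hcpos : 0 < ‖c‖ := by rw [hcn]; positivity
  have := hy (c • ⟨w, hw⟩) (by
    rw [mem_sphere_zero_iff_norm, norm_smul, hcn]
    exact inv_mul_cancel₀ hw0.ne')
  simp only [SetLike.mk_smul_mk, map_smul, norm_smul, mul_left_comm ρ] at this
  exact ⟨le_of_mul_le_mul_left this.1.le hcpos, le_of_mul_le_mul_left this.2.le hcpos⟩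

/-- A finite-dimensional space of sections on which evaluation at `x` is an isomorphism onto the
space of all values at `x`. -/
theorem exists_section_space (x : X) [FiniteDimensional 𝕜 (E x)] :
    ∃ W : Submodule 𝕜 (BoundedSections 𝕜 E), FiniteDimensional 𝕜 W ∧
      (∀ w ∈ W, eval 𝕜 E x w = 0 → w = 0) ∧
      (∀ s, ∃ w ∈ W, eval 𝕜 E x w = eval 𝕜 E x s) ∧
      Module.finrank 𝕜 W = Module.finrank 𝕜 (values 𝕜 E x) := by
  obtain ⟨W, hW⟩ := Submodule.exists_isCompl (LinearMap.ker (eval 𝕜 E x))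
  have hinj : ∀ w ∈ W, eval 𝕜 E x w = 0 → w = 0 := fun w hw h0 =>
    (Submodule.disjoint_def.1 hW.disjoint) w h0 hw
  have hsurj : ∀ s, ∃ w ∈ W, eval 𝕜 E x w = eval 𝕜 E x s := fun s => by
    obtain ⟨k, hk, w, hw, rfl⟩ := Submodule.mem_sup.1 (hW.sup_eq_top ▸ Submodule.mem_top :
      s ∈ LinearMap.ker (eval 𝕜 E x) ⊔ W)
    exact ⟨w, hw, by rw [map_add, LinearMap.mem_ker.1 hk, zero_add]⟩
  let L : W →ₗ[𝕜] values 𝕜 E x := (eval 𝕜 E x).rangeRestrict ∘ₗ W.subtype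
  have hL : Function.Injective L := (injective_iff_map_eq_zero L).2 fun w hw =>
    Subtype.ext (hinj w w.2 (congrArg Subtype.val hw))
  have hL' : Function.Surjective L := by
    rintro ⟨_, s, rfl⟩
    obtain ⟨w, hw, h⟩ := hsurj s
    exact ⟨⟨w, hw⟩, Subtype.ext h⟩
  exact ⟨W, FiniteDimensional.of_injective L hL, hinj, hsurj,
    (LinearEquiv.ofBijective L ⟨hL, hL'⟩).finrank_eq⟩

/-- The continuous seminorm `s ↦ q (s x)` on the space of sections. -/
noncomputable def inducedSeminorm (x : X) (q : Seminorm 𝕜 (E x)) {B : ℝ}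
    (hq : ∀ v, q v ≤ B * ‖v‖) : ContSeminorm 𝕜 (BoundedSections 𝕜 E) :=
  ⟨q.comp (eval 𝕜 E x), Seminorm.continuous_of_le
    -- B carries no sign hypothesis, hence the truncation.
    (q := B.toNNReal • normSeminorm 𝕜 (BoundedSections 𝕜 E))
    (continuous_const.mul continuous_norm) fun s => by
      change q (eval 𝕜 E x s) ≤ B.toNNReal * ‖s‖
      calc _ ≤ B * ‖eval 𝕜 E x s‖ := hq _
        _ ≤ B.toNNReal * ‖eval 𝕜 E x s‖ := by gcongr; exact Real.le_coe_toNNReal B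
        _ ≤ _ := by gcongr; exact norm_eval_le x s⟩

theorem tendsto_contSeminorm {ι V : Type*} [NormedAddCommGroup V] [NormedSpace 𝕜 V] {l : Filter ι}
    {p : ι → ContSeminorm 𝕜 V} {p₀ : ContSeminorm 𝕜 V} :
    Tendsto p l (𝓝 p₀) ↔ ∀ v, Tendsto (fun i => (p i).1 v) l (𝓝 (p₀.1 v)) := by
  rw [nhds_induced, tendsto_comap_iff, tendsto_pi_nhds]
  rfl

/-! ### The renorming and its closedness -/

variable (E) in
/-- The Hilbert norms on the fiber over `x` which are equivalent to the given norm with constant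
`B`, and, on the values of sections, with a constant depending on the dimension of the space of
those. -/
def hilbertRenorming (C : ℕ → ℝ) (B : ℝ) (x : X) : Set (Seminorm 𝕜 (E x)) :=
  {q | q.IsParallelogram ∧ q.EquivOn B Set.univ ∧
    q.EquivOn (C (Module.finrank 𝕜 (values 𝕜 E x))) (values 𝕜 E x)}

theorem isL2Convex_hilbertRenorming {C : ℕ → ℝ} {B : ℝ} (hC : ∀ m, 0 < C m) (hB : 0 < B)
    (x : X) : IsL2Convex (hilbertRenorming (𝕜 := 𝕜) E C B x) :=
  fun _ hp _ hq t => ⟨hp.1.l2Comb hq.1 t, hp.2.1.l2Comb hB hq.2.1 t,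
    hp.2.2.l2Comb (hC _) hq.2.2 t⟩

/-- Each defining condition is closed in finitely many values of the function, and the upper bound
B‖v‖ confines it to a product of compact intervals, so Tychonoff applies. -/
theorem isCompact_coe_hilbertRenorming (C : ℕ → ℝ) (B : ℝ) (x : X) :
    IsCompact ((fun (q : Seminorm 𝕜 (E x)) v => q v) '' hilbertRenorming E C B x) := by
  have hS : (fun (q : Seminorm 𝕜 (E x)) v => q v) '' hilbertRenorming E C B x =
      {f : E x → ℝ | (∀ v w, f (v + w) ≤ f v + f w) ∧ (∀ (c : 𝕜) v, f (c • v) = ‖c‖ * f v) ∧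
        (∀ v w, f (v + w) ^ 2 + f (v - w) ^ 2 = 2 * (f v ^ 2 + f w ^ 2)) ∧
        (∀ v ∈ (Set.univ : Set (E x)), f v ≤ B * ‖v‖ ∧ ‖v‖ ≤ B * f v) ∧
        ∀ v ∈ (values 𝕜 E x : Set (E x)),
          f v ≤ C (Module.finrank 𝕜 (values 𝕜 E x)) * ‖v‖ ∧
            ‖v‖ ≤ C (Module.finrank 𝕜 (values 𝕜 E x)) * f v} := by
    ext f
    constructor
    · rintro ⟨q, ⟨h1, h2, h3⟩, rfl⟩
      exact ⟨map_add_le_add q, map_smul_eq_mul q, h1, h2, h3⟩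
    · rintro ⟨h1, h2, h3, h4, h5⟩
      exact ⟨Seminorm.of f h1 h2, ⟨h3, h4, h5⟩, rfl⟩
  have hclosed : IsClosed ((fun (q : Seminorm 𝕜 (E x)) v => q v) '' hilbertRenorming E C B x) := by
    rw [hS]
    simp only [Set.ofPred_and, Set.ofPred_forall]
    refine IsClosed.inter ?_ (IsClosed.inter ?_ (IsClosed.inter ?_ (IsClosed.inter ?_ ?_)))
    · exact isClosed_iInter fun v => isClosed_iInter fun w =>
        isClosed_le (by fun_prop) (by fun_prop)
    · exact isClosed_iInter fun v => isClosed_iInter fun w =>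
        isClosed_eq (by fun_prop) (by fun_prop)
    · exact isClosed_iInter fun v => isClosed_iInter fun w =>
        isClosed_eq (by fun_prop) (by fun_prop)
    all_goals exact isClosed_iInter fun v => isClosed_iInter fun _ =>
        (isClosed_le (by fun_prop) (by fun_prop)).inter (isClosed_le (by fun_prop) (by fun_prop))
  refine (isCompact_univ_pi fun v : E x => isCompact_Icc (a := 0) (b := B * ‖v‖)).of_isClosed_subset
    hclosed ?_
  rintro _ ⟨q, hq, rfl⟩ v _
  exact ⟨apply_nonneg q v, (hq.2.1 v trivial).1⟩

/-- A limit of induced seminorms must be shown to come from a norm on the whole fiber, although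
sections may not reach all of it. Compactness provides this: the continuous image of a compact set
is compact, hence closed in the Hausdorff space of functions. -/
theorem isClosed_inducedSeminorms_hilbertRenorming (C : ℕ → ℝ) (B : ℝ) (x : X) :
    IsClosed (inducedSeminorms (hilbertRenorming (𝕜 := 𝕜) E C B) x) := by
  have hc : Continuous fun (f : E x → ℝ) (s : BoundedSections 𝕜 E) => f (eval 𝕜 E x s) := by
    fun_prop
  have := ((isCompact_coe_hilbertRenorming (𝕜 := 𝕜) (E := E) C B x).image hc).isClosed.preimage
    (continuous_induced_dom : Continuous fun (p : ContSeminorm 𝕜 (BoundedSections 𝕜 E)) v => p.1 v)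
  refine (congrArg IsClosed (Set.ext fun p => ?_)).mpr this
  constructor
  · rintro ⟨q, hq, h⟩
    exact ⟨_, ⟨q, hq, rfl⟩, funext fun s => (h s).symm⟩
  · rintro ⟨_, ⟨q, hq, rfl⟩, h⟩
    exact ⟨q, hq, fun s => (congrFun h s).symm⟩

/-! ### Transport and lower semicontinuity -/

/-- Hilbert norms with strictly better constant on the values of sections propagate to nearby
fibers. -/
theorem eventually_exists_transport {C : ℕ → ℝ} {A B : ℝ} {n : ℕ} (hA : 1 ≤ A)
    (hT : ∀ x, Module.finrank 𝕜 (E x) ≤ n ∧ ∃ (d : ℕ) (T : E x →ₗ[𝕜] EuclideanSpace 𝕜 (Fin d)),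
      ∀ v, ‖v‖ ≤ A * ‖T v‖ ∧ ‖T v‖ ≤ A * ‖v‖)
    (hfin : ∀ x, FiniteDimensional 𝕜 (E x))
    (hC : Monotone C) (hC1 : ∀ m, 1 < C m) (hCA : ∀ m, A ^ 2 * C m ≤ C (m + 1))
    (hB : C (n + 1) ≤ B) {x : X} {q : Seminorm 𝕜 (E x)} (hq : q.IsParallelogram) {c : ℝ}
    (hc : c < C (Module.finrank 𝕜 (values 𝕜 E x)))
    (hqc : q.EquivOn c (values 𝕜 E x)) {W : Submodule 𝕜 (BoundedSections 𝕜 E)}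
    [FiniteDimensional 𝕜 W] (hW : ∀ w ∈ W, eval 𝕜 E x w = 0 → w = 0)
    (hWd : Module.finrank 𝕜 W = Module.finrank 𝕜 (values 𝕜 E x)) :
    ∀ᶠ y in 𝓝 x, ∃ q' ∈ hilbertRenorming (𝕜 := 𝕜) E C B y,
      ∀ w ∈ W, q' (eval 𝕜 E y w) = q (eval 𝕜 E x w) := by
  set m := Module.finrank 𝕜 (values 𝕜 E x) with hm
  have hmn : m ≤ n := (Submodule.finrank_le _).trans (hT x).1
  -- The maximum makes a positive while keeping a < C m. The allowed distortion ρ = C m / a then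
  -- uses up exactly the slack.
  set a := max c 1 with ha
  have ha1 : 1 ≤ a := le_max_right _ _
  have haC : a < C m := max_lt hc (hC1 m)
  have hqa : q.EquivOn a (values 𝕜 E x) := hqc.mono (le_max_left _ _) subset_rfl
  have hρ : 1 < C m / a := (one_lt_div (by positivity)).2 haC
  filter_upwards [eventually_norm_eval_le W hW hρ] with y hy
  obtain ⟨d, T, hTd⟩ := (hT y).2
  have hCm : 0 < C m := by linarith [hC1 m]
  let L : W →ₗ[𝕜] E y := eval 𝕜 E y ∘ₗ W.subtype
  have hb : ∀ w : W, q (eval 𝕜 E x w) ≤ C m * ‖L w‖ ∧ ‖L w‖ ≤ C m * q (eval 𝕜 E x w) := by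
    intro w
    obtain ⟨h1, h2⟩ := hqa (eval 𝕜 E x w) ⟨_, rfl⟩
    obtain ⟨h3, h4⟩ := hy w w.2
    constructor
    · calc _ ≤ a * ‖eval 𝕜 E x w‖ := h1
        _ ≤ a * (C m / a * ‖eval 𝕜 E y w‖) := by gcongr
        _ = C m * ‖eval 𝕜 E y w‖ := by field_simp
    · calc ‖eval 𝕜 E y w‖ ≤ C m / a * ‖eval 𝕜 E x w‖ := h3
        _ ≤ C m / a * (a * q (eval 𝕜 E x w)) := by gcongr
        _ = C m * q (eval 𝕜 E x w) := by field_simp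
  have hL : Function.Injective L := (injective_iff_map_eq_zero L).2 fun w hw => by
    refine Subtype.ext (hW w w.2 ?_)
    have h4 := (hy w w.2).2
    rw [show eval 𝕜 E y w = 0 from hw, norm_zero, mul_zero] at h4
    exact norm_le_zero_iff.1 h4
  obtain ⟨q', hpar, hext, heq⟩ := Seminorm.exists_extension T hA (hC1 m).le hTd L hL
    (q.comp (eval 𝕜 E x ∘ₗ W.subtype)) (hq.comp _) hb
  -- Even for m = n the extension to all of E y may cost A², which is why B dominates C (n + 1) and
  -- not merely C n.
  refine ⟨q', ⟨hpar, heq.mono (((hCA m).trans (hC (by omega))).trans hB) subset_rfl, ?_⟩,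
    fun w hw => hext ⟨w, hw⟩⟩
  have hfr : Module.finrank 𝕜 (LinearMap.range L) = m := by
    rw [LinearMap.finrank_range_of_inj hL, hWd]
  have hle : LinearMap.range L ≤ values 𝕜 E y := by
    rintro _ ⟨w, rfl⟩
    exact ⟨w, rfl⟩
  have hmle : m ≤ Module.finrank 𝕜 (values 𝕜 E y) := hfr ▸ Submodule.finrank_mono hle
  -- In equal dimension the image of W exhausts the values at y, so the bound on W suffices without
  -- loss. If the dimension jumps, the next value of C pays for the extension.
  rcases hmle.eq_or_lt with h | h
  · rw [← h, ← Submodule.eq_of_le_of_finrank_eq hle (hfr.trans h)]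
    rintro _ ⟨w, rfl⟩
    rw [hext]
    exact hb w
  · exact heq.mono ((hCA m).trans (hC h)) (Set.subset_univ _)

/-- Seminorms on nearby fibers agreeing with a given one on a space of sections exhausting the
values at `x` converge to it. -/
theorem tendsto_inducedSeminorm {x : X} {q : Seminorm 𝕜 (E x)} {B : ℝ}
    (hq : ∀ v, q v ≤ B * ‖v‖) {Q : ∀ y, Seminorm 𝕜 (E y)} (hQ : ∀ y v, Q y v ≤ B * ‖v‖)
    {W : Submodule 𝕜 (BoundedSections 𝕜 E)}
    (hW : ∀ s, ∃ w ∈ W, eval 𝕜 E x w = eval 𝕜 E x s)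
    (h : ∀ᶠ y in 𝓝 x, ∀ w ∈ W, Q y (eval 𝕜 E y w) = q (eval 𝕜 E x w)) :
    Tendsto (fun y => inducedSeminorm y (Q y) (hQ y)) (𝓝 x) (𝓝 (inducedSeminorm x q hq)) := by
  rw [tendsto_contSeminorm]
  intro s
  change Tendsto (fun y => Q y (eval 𝕜 E y s)) _ (𝓝 (q (eval 𝕜 E x s)))
  obtain ⟨w, hw, hws⟩ := hW s
  rw [tendsto_iff_dist_tendsto_zero]
  -- The section s - w vanishes at x, so replacing s by w near x costs little in every seminorm
  -- bounded by B times the norm.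
  have h0 : Tendsto (fun y => B * ‖eval 𝕜 E y (s - w)‖) (𝓝 x) (𝓝 0) := by
    have := ((continuous_norm_eval (s - w)).const_mul B).tendsto x
    rwa [map_sub (eval 𝕜 E x), hws, sub_self, norm_zero, mul_zero] at this
  refine squeeze_zero' (Eventually.of_forall fun _ => dist_nonneg) ?_ h0
  filter_upwards [h] with y hy
  rw [← hws, ← hy w hw]
  calc _ ≤ Q y (eval 𝕜 E y s - eval 𝕜 E y w) := abs_sub_map_le_sub _ _ _
    _ = Q y (eval 𝕜 E y (s - w)) := by rw [map_sub (eval 𝕜 E y)]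
    _ ≤ _ := hQ _ _

/-- An open set meeting the induced seminorms at x also contains one from a mixture of q with `h x`
for some t < 1. That mixture has strict slack and can be transported. -/
theorem lowerHemicontinuous_hilbertRenorming {C : ℕ → ℝ} {A B : ℝ} {n : ℕ} (hA : 1 ≤ A)
    (hT : ∀ x, Module.finrank 𝕜 (E x) ≤ n ∧ ∃ (d : ℕ) (T : E x →ₗ[𝕜] EuclideanSpace 𝕜 (Fin d)),
      ∀ v, ‖v‖ ≤ A * ‖T v‖ ∧ ‖T v‖ ≤ A * ‖v‖)
    (hfin : ∀ x, FiniteDimensional 𝕜 (E x))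
    (hC : Monotone C) (hAC : ∀ m, A < C m) (hCA : ∀ m, A ^ 2 * C m ≤ C (m + 1))
    (hB : C (n + 1) ≤ B) :
    LowerHemicontinuous (inducedSeminorms (hilbertRenorming (𝕜 := 𝕜) E C B)) := by
  have hAB : A < B := (hAC _).trans_le hB
  have hA0 : 0 < A := by linarith
  have hh : ∀ x, ∃ h : Seminorm 𝕜 (E x), h.IsParallelogram ∧ h.EquivOn A Set.univ := fun x => by
    obtain ⟨d, T, hTd⟩ := (hT x).2
    exact ⟨(normSeminorm 𝕜 _).comp T, Seminorm.isParallelogram_normSeminorm.comp T,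
      fun v _ => ⟨(hTd v).2, (hTd v).1⟩⟩
  choose h hpar heq using hh
  have hK : ∀ x, h x ∈ hilbertRenorming (𝕜 := 𝕜) E C B x := fun x =>
    ⟨hpar x, (heq x).mono hAB.le subset_rfl, (heq x).mono (hAC _).le (Set.subset_univ _)⟩
  rw [lowerHemicontinuous_iff]
  intro x
  rw [lowerHemicontinuousAt_iff]
  rintro V hV ⟨p, ⟨q, hq, hpq⟩, hpV⟩
  have hconv := isL2Convex_hilbertRenorming (𝕜 := 𝕜) (E := E) (C := C) (B := B)
    (fun m => hA0.trans (hAC m)) (hA0.trans hAB) x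
  have hbd : ∀ t v, Seminorm.l2Comb t q (h x) v ≤ B * ‖v‖ := fun t v =>
    ((hconv q hq (h x) (hK x) t).2.1 v trivial).1
  have hlim : Tendsto (fun t => inducedSeminorm x (Seminorm.l2Comb t q (h x)) (hbd t))
      (𝓝 (1 : unitInterval)) (𝓝 p) := by
    rw [tendsto_contSeminorm]
    intro s
    change Tendsto (fun t : unitInterval => Real.sqrt ((t : ℝ) * q (eval 𝕜 E x s) ^ 2 +
      (1 - (t : ℝ)) * h x (eval 𝕜 E x s) ^ 2)) (𝓝 1) _
    have hc : Continuous fun t : unitInterval => Real.sqrt ((t : ℝ) * q (eval 𝕜 E x s) ^ 2 +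
      (1 - (t : ℝ)) * h x (eval 𝕜 E x s) ^ 2) := by fun_prop
    have := hc.tendsto 1
    simpa [hpq, eval_apply] using this
  have hne : (𝓝[<] (1 : unitInterval)).NeBot := nhdsLT_neBot_of_exists_lt ⟨0, zero_lt_one⟩
  obtain ⟨t, htV, ht⟩ := (((hlim.eventually (hV.mem_nhds hpV)).filter_mono
    nhdsWithin_le_nhds).and (self_mem_nhdsWithin : Set.Iio 1 ∈ 𝓝[<] (1 : unitInterval))).exists
  obtain ⟨c, -, hcC, hqc⟩ := hq.2.2.exists_lt_l2Comb hA0 (hAC _)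
    ((heq x).mono le_rfl (Set.subset_univ _)) ht
  have := hfin x
  obtain ⟨W, hWf, hWi, hWs, hWd⟩ := exists_section_space (𝕜 := 𝕜) (E := E) x
  have hev := eventually_exists_transport hA hT hfin hC (fun m => hA.trans_lt (hAC m)) hCA hB
    (hq.1.l2Comb (hpar x) t) hcC hqc hWi hWd
  -- Convergence is stated for a family over all y; where transport is unavailable, the Euclidean
  -- norm `h y` is the default.
  have hQ : ∀ y, ∃ q' ∈ hilbertRenorming (𝕜 := 𝕜) E C B y,
      (∃ q' ∈ hilbertRenorming (𝕜 := 𝕜) E C B y,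
        ∀ w ∈ W, q' (eval 𝕜 E y w) = Seminorm.l2Comb t q (h x) (eval 𝕜 E x w)) →
      ∀ w ∈ W, q' (eval 𝕜 E y w) = Seminorm.l2Comb t q (h x) (eval 𝕜 E x w) := fun y => by
    by_cases hy : ∃ q' ∈ hilbertRenorming (𝕜 := 𝕜) E C B y,
        ∀ w ∈ W, q' (eval 𝕜 E y w) = Seminorm.l2Comb t q (h x) (eval 𝕜 E x w)
    · obtain ⟨q', h1, h2⟩ := hy
      exact ⟨q', h1, fun _ => h2⟩
    · exact ⟨h y, hK y, fun h => absurd h hy⟩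
  choose Q hQK hQe using hQ
  have := tendsto_inducedSeminorm (hbd t) (fun y v => ((hQK y).2.1 v trivial).1) hWs
    (hev.mono hQe)
  filter_upwards [this.eventually (hV.mem_nhds htV)] with y hy
  exact ⟨_, ⟨Q y, hQK y, fun s => rfl⟩, hy⟩

end BoundedSections

/-! ### Choice of constants and conclusion -/

open BoundedSections in
theorem mainTheorem2 {𝕜 : Type*} [RCLike 𝕜] {X : Type*} [TopologicalSpace X] [T2Space X]
    [LocallyParacompactSpace X] (E : X → Type*)
    [∀ x, NormedAddCommGroup (E x)] [∀ x, NormedSpace 𝕜 (E x)]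
    [TopologicalSpace (BundleTotal E)] [IsBanachBundle 𝕜 E] (hE : IsSubhomogeneous 𝕜 E) :
    ∃ K : ∀ x, Set (Seminorm 𝕜 (E x)),
      IsEquivalentMultiRenorming K ∧
      (∀ x, ∀ q ∈ K x, q.IsHilbertNorm) ∧
      LowerHemicontinuous (inducedSeminorms K) ∧
      ∀ x, (K x).Nonempty ∧ IsClosed (inducedSeminorms K x) ∧ IsL2Convex (K x) := by
  obtain ⟨n, hn⟩ := hE
  have hfin : ∀ x, FiniteDimensional 𝕜 (E x) := fun x =>
    Module.rank_lt_aleph0_iff.1 ((hn x).trans_lt (Cardinal.natCast_lt_aleph0))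
  have hrank : ∀ x, Module.finrank 𝕜 (E x) ≤ n := fun x => Module.finrank_le_of_rank_le (hn x)
  obtain ⟨A, hA, hAT⟩ := exists_euclidean_bound 𝕜 n
  have hT := fun x => hAT (E x) (hrank x)
  have hA2 : 1 ≤ A ^ 2 := one_le_pow₀ hA
  -- The ratio A² pays for one extension, and the factor 2 makes A < C m strict already at m = 0.
  let C : ℕ → ℝ := fun m => 2 * A * (A ^ 2) ^ m
  have hAC : ∀ m, A < C m := fun m => by
    have : 2 * A ≤ C m := le_mul_of_one_le_right (by positivity) (one_le_pow₀ hA2)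
    linarith
  have hC : Monotone C := fun i j hij => by
    have := pow_le_pow_right₀ hA2 hij
    simp only [C]
    gcongr
  have hCA : ∀ m, A ^ 2 * C m ≤ C (m + 1) := fun m => le_of_eq (by simp only [C]; ring)
  have hB0 : 0 < C (n + 1) := by linarith [hAC (n + 1)]
  have hnorm : ∀ x, ∀ q ∈ hilbertRenorming (𝕜 := 𝕜) E C (C (n + 1)) x, q.IsNorm := by
    intro x q hq v hv
    have := (hq.2.1 v trivial).2
    rw [hv, mul_zero] at this
    exact norm_le_zero_iff.1 this
  refine ⟨hilbertRenorming E C (C (n + 1)), ⟨hnorm, ?_, C (n + 1), hB0, ?_⟩, ?_, ?_, ?_⟩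
  · let B : ℝ≥0 := ⟨C (n + 1), hB0.le⟩
    refine lt_of_le_of_lt (b := (B : ℝ≥0∞) * B) (iSup_le fun x => iSup₂_le fun q hq => ?_)
      (ENNReal.mul_lt_top ENNReal.coe_lt_top ENNReal.coe_lt_top)
    exact Seminorm.EquivOn.banachMazurDist_le (C := B) hq.2.1
  · exact fun x q hq v => hq.2.1 v trivial
  · exact fun x q hq => hq.1.isHilbertNorm (hnorm x q hq)
  · exact lowerHemicontinuous_hilbertRenorming hA (fun x => ⟨hrank x, hT x⟩) hfin hC hAC hCA le_rfl
  · refine fun x => ⟨?_, isClosed_inducedSeminorms_hilbertRenorming _ _ _,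
      isL2Convex_hilbertRenorming (fun m => by linarith [hAC m]) hB0 x⟩
    obtain ⟨d, T, hTd⟩ := hT x
    have heq : Seminorm.EquivOn A Set.univ ((normSeminorm 𝕜 _).comp T) :=
      fun v _ => ⟨(hTd v).2, (hTd v).1⟩
    exact ⟨(normSeminorm 𝕜 _).comp T, Seminorm.isParallelogram_normSeminorm.comp T,
      heq.mono (hAC _).le subset_rfl, heq.mono (hAC _).le (Set.subset_univ _)⟩
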